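/- Let $\kappa$ be a regular cardinal and let $(\mathcal K,U)$ be a weak $\kappa$-CAEC: $\mathcal K$ is an accessible category with directed colimits all of whose morphisms are monomorphisms, and $U:\mathcal K\to\mathbf{Set}$ is a faithful functor that preserves monomorphisms and $\kappa$-directed colimits and is coherent (whenever $h:A\to C$ and $g:B\to C$ are morphisms of $\mathcal K$ and $f:UA\to UB$ is a map with $U(g)f=U(h)$, there is $f':A\to B$ in $\mathcal K$ with $U(f')=f$). Assume that $\mathcal K$ has the amalgamation property. Let $\mathcal K$ be $\lambda$-accessible, $\lambda$ regular, and let $\lambda_U\ge\lambda$ be the least regular cardinal $\theta\geq\lambda$ such that $U$ takes $\theta$-presentable objects to $\theta$-presentable objects (i.e. to sets of cardinality less than $\theta$). An object has size $\mu$ if the least regular cardinal $\theta$ for which it is $\theta$-presentable is $\mu^+$; it has size at most $\mu$ if it is $\mu^+$-presentable. Two pairs $(f_0,a_0)$, $(f_1,a_1)$ with $f_i:M\to N_i$ and $a_i\in U(N_i)$ represent the same Galois type over $M$ if there are $h_i:N_i\to P$ with $h_0f_0=h_1f_1$ and $U(h_0)(a_0)=U(h_1)(a_1)$. Given $g:M\to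 M'$, the object $M'$ realizes all types over $M$ if every pair $(f,a)$ over $M$ represents the same type as $(g,b)$ for some $b\in U(M')$. A morphism $m:M\to\bar M$ is a $1$-special extension, where $M$ and $\bar M$ are of size $\mu$, if there is a continuous chain $M=M_0\to M_1\to\dots\to M_i\to\dots$ $(i<\mu)$ with colimit $\bar M$ and $m$ the colimit map from $M_0$, such that $M_{i+1}$ realizes all types over $M_i$ (via $M_i\to M_{i+1}$) for all $i<\mu$. Let $\mu$ be an infinite cardinal such that $\kappa$ is sharply smaller than $\mu^+$ ($\mu^+\rhd\kappa$) and $\mu\ge\lambda_U$, and let $m:M\to\bar M$ be a $1$-special extension with $M$ and $\bar M$ of size $\mu$. Then $\bar M$ is universal over $M$: for every $h:M\to N$ with $N$ of size at most $\mu$ there is $t:N\to\bar M$ such that $th=m$. -/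

import Mathlib

universe w v u

open CategoryTheory CategoryTheory.Limits

namespace WeakCAEC

section

variable {K : Type u} [Category.{v} K] (U : K ⥤ Type w)

/-- The pair `(K, U)` is coherent: a map of underlying sets `f : UA → UB` with `U(g) ∘ f = U(h)`
for some morphisms `h : A ⟶ C` and `g : B ⟶ C` underlies a morphism `A ⟶ B`. -/
def IsCoherent : Prop :=
  ∀ ⦃A B C : K⦄ (h : A ⟶ C) (g : B ⟶ C) (f : U.obj A ⟶ U.obj B),
    f ≫ U.map g = U.map h → ∃ f' : A ⟶ B, U.map f' = f

/-- `(K, U)` is a weak `κ`-concrete abstract elementary class (`κ` a regular cardinal). -/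
structure IsWeakCAEC (κ : Cardinal.{w}) [Fact κ.IsRegular] : Prop where
  faithful : U.Faithful
  accessible : IsAccessibleCategory.{w} K
  hasDirectedColimits : HasFilteredColimitsOfSize.{w, w} K
  mono : ∀ ⦃A B : K⦄ (f : A ⟶ B), Mono f
  coherent : IsCoherent U
  concreteMonos : U.PreservesMonomorphisms
  preservesDirectedColimits : U.IsCardinalAccessible κ

variable (K) in
/-- The amalgamation property. -/
def HasAmalgamation : Prop :=
  ∀ ⦃M N₀ N₁ : K⦄ (f₀ : M ⟶ N₀) (f₁ : M ⟶ N₁),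
    ∃ (P : K) (h₀ : N₀ ⟶ P) (h₁ : N₁ ⟶ P), f₀ ≫ h₀ = f₁ ≫ h₁

/-- The pairs `(f₀, a₀)` and `(f₁, a₁)`, with `fᵢ : M ⟶ Nᵢ` and `aᵢ ∈ U(Nᵢ)`, represent the same
Galois (1-)type over `M`. -/
def SameType {M N₀ N₁ : K} (f₀ : M ⟶ N₀) (a₀ : U.obj N₀) (f₁ : M ⟶ N₁) (a₁ : U.obj N₁) : Prop :=
  ∃ (P : K) (h₀ : N₀ ⟶ P) (h₁ : N₁ ⟶ P),
    f₀ ≫ h₀ = f₁ ≫ h₁ ∧ U.map h₀ a₀ = U.map h₁ a₁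

/-- The property of a morphism `g : M ⟶ M'` that `M'` realizes, via `g`, all types over `M`. -/
def realizesAllTypes : MorphismProperty K := fun M M' g ↦
  ∀ ⦃N : K⦄ (f : M ⟶ N) (a : U.obj N), ∃ b : U.obj M', SameType U f a g b

/-- `m : M ⟶ M'` exhibits `M'` as a 1-special extension of `M` (for `M`, `M'` of size `μ`):
`m` is the map from the first object to the colimit of a continuous chain
`M = M₀ ⟶ M₁ ⟶ ⋯ ⟶ Mᵢ ⟶ ⋯` (`i < μ`) such that `Mᵢ₊₁` realizes all types over `Mᵢ`.
(The order on `μ.ord.ToType` is the well-order of type `μ`; a least element exists, and is unique,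
for `μ ≠ 0`.) -/
def IsOneSpecial (μ : Cardinal.{w}) {M M' : K} (m : M ⟶ M') : Prop :=
  ∃ _ : OrderBot μ.ord.ToType,
    Nonempty ((realizesAllTypes U).TransfiniteCompositionOfShape μ.ord.ToType m)

/-- `M` is of size `μ`: its presentability rank, the least regular cardinal `θ` such that
`M` is `θ`-presentable, is `μ⁺`. -/
def HasSize (M : K) (μ : Cardinal.{w}) [Fact (Order.succ μ).IsRegular] : Prop :=
  IsCardinalPresentable M (Order.succ μ) ∧
    ∀ (θ : Cardinal.{w}) [Fact θ.IsRegular], IsCardinalPresentable M θ → Order.succ μ ≤ θ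

/-- `M` is of size at most `μ`: its presentability rank is at most `μ⁺`. -/
def HasSizeLE (M : K) (μ : Cardinal.{w}) [Fact (Order.succ μ).IsRegular] : Prop :=
  IsCardinalPresentable M (Order.succ μ)

/-- `M'` is `μ`-universal over `M` (via `m`); for `M` and `M'` of size `μ`, one says that
`M'` is universal over `M`. -/
def IsUniversalOver (μ : Cardinal.{w}) [Fact (Order.succ μ).IsRegular]
    {M M' : K} (m : M ⟶ M') : Prop :=
  ∀ ⦃N : K⦄ (h : M ⟶ N), HasSizeLE M μ → HasSizeLE N μ → ∃ t : N ⟶ M', h ≫ t = m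

/-- `U` preserves `θ`-presentable objects. -/
def PreservesPresentable (θ : Cardinal.{w}) [Fact θ.IsRegular] : Prop :=
  ∀ ⦃X : K⦄, IsCardinalPresentable X θ → IsCardinalPresentable (U.obj X) θ

/-- The cardinal `λ_U`: the least regular cardinal `θ ≥ lam` such that `U` preserves
`θ`-presentable objects. -/
noncomputable def lambdaU (lam : Cardinal.{w}) : Cardinal.{w} :=
  sInf {θ | lam ≤ θ ∧ ∃ _ : Fact θ.IsRegular, PreservesPresentable U θ}

end

end WeakCAEC

/-! Elements of an extension `N` of `M` are absorbed one at a time along the chain. Its stages are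
embedded successively into growing extensions of `N`, starting from `h`. Since the stage after `Mᵢ`
realizes the type over `Mᵢ` of the `i`-th prescribed element, the amalgam can be chosen so that this
element falls in the image of that stage; at limits, continuity supplies the map. The result
(`exists_amalgam`) is `g : M' ⟶ P` and `k : N ⟶ P`, agreeing on `M`, with up to `μ` prescribed
elements sent by `k` into the image of `g`.

The cardinality of `U(N)` need not be bounded: `N` is a retract of a directed colimit of at most `μ`
`lam`-presentable objects `Dᵢ` (`exists_retract_partialColimits`), and `U(Dᵢ)` has fewer than `λ_U ≤
μ` elements (`lambdaU_spec`). Prescribing the elements coming from the `Dᵢ`, coherence factors each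
`Dᵢ ⟶ N ⟶ P` through `g`. As `g` is mono, the factorizations glue to the colimit; composing with the
section from `N` gives `t` with `t ≫ g = k`, and cancelling `g` gives `h ≫ t = m`. -/

namespace WeakCAEC

/-! ### Directed colimits as colimits of small partial colimits -/

section DirectedSubsets

variable {I : Type w} [PartialOrder I]

/-- In a directed poset, subsets of cardinality less than an uncountable regular cardinal `θ`
are contained in directed subsets of cardinality less than `θ`. -/
lemma exists_directed_superset [IsFiltered I] {θ : Cardinal.{w}} [Fact θ.IsRegular]
    (hθ : Cardinal.aleph0 < θ) (A : Set I) (hA : HasCardinalLT A θ) :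
    ∃ B : Set I, A ⊆ B ∧ IsFiltered B ∧ HasCardinalLT B θ := by
  have := Cardinal.fact_isRegular_aleph0.{w}
  have : IsCardinalFiltered I Cardinal.aleph0.{w} :=
    (isCardinalFiltered_aleph0_iff I).2 inferInstance
  -- This is `ℵ₀ ◁ θ`: a set of cardinality `< θ` has fewer than `θ` finite subsets, so the cofinal
  -- family can be all of them.
  obtain ⟨B, h₁, h₂, h₃⟩ :=
    Cardinal.SharplyLT.exists_isCardinalFiltered_set_of_exists_cofinal hθ (fun X hX ↦ by
      refine ⟨Set.univ, ?_, fun x ↦ ⟨x, Set.mem_univ _, le_rfl⟩⟩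
      have h : HasCardinalLT (Finset X) θ := by
        rw [hasCardinalLT_iff_cardinal_mk_lt] at hX ⊢
        obtain hf | hf := finite_or_infinite X
        · exact (Cardinal.lt_aleph0_of_finite _).trans hθ
        · rwa [Cardinal.mk_finset_of_infinite]
      have hfin (S : (Set.univ : Set (CardinalDirectedPoset.SetCardinalLT Cardinal.aleph0 X))) :
          (S.1.1 : Set X).Finite := (hasCardinalLT_aleph0_iff _).1 S.1.2
      refine h.of_injective (fun S ↦ (hfin S).toFinset) (fun S T hST ↦ ?_)
      exact Subtype.ext (Subtype.ext (Set.Finite.toFinset_inj.1 hST))) A hA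
  exact ⟨B, h₁, (isCardinalFiltered_aleph0_iff B).1 h₂, h₃⟩

variable (I) in
/-- The poset of directed subsets of cardinality `< θ` of a poset. -/
abbrev DirectedSubset (θ : Cardinal.{w}) : Type w :=
  { A : Set I // IsFiltered A ∧ HasCardinalLT A θ }

instance isFiltered_directedSubset {θ : Cardinal.{w}} (A : DirectedSubset I θ) :
    IsFiltered A.1 := A.2.1

lemma exists_directedSubset [IsFiltered I] {θ : Cardinal.{w}} [Fact θ.IsRegular]
    (hθ : Cardinal.aleph0 < θ) (A : Set I) (hA : HasCardinalLT A θ) :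
    ∃ B : DirectedSubset I θ, A ⊆ B.1 := by
  obtain ⟨B, h, h'⟩ := exists_directed_superset hθ A hA
  exact ⟨⟨B, h'⟩, h⟩

lemma isCardinalFiltered_directedSubset [IsFiltered I] {θ : Cardinal.{w}} [Fact θ.IsRegular]
    (hθ : Cardinal.aleph0 < θ) : IsCardinalFiltered (DirectedSubset I θ) θ :=
  isCardinalFiltered_preorder _ _ (fun ι A hι ↦ by
    obtain ⟨B, hB⟩ := exists_directedSubset hθ (⋃ i, (A i).1)
      (hasCardinalLT_iUnion _ (by rwa [hasCardinalLT_iff_cardinal_mk_lt]) (fun i ↦ (A i).2.2))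
    exact ⟨B, fun i ↦ (Set.subset_iUnion (fun i ↦ (A i).1) i).trans hB⟩)

variable {K : Type u} [Category.{v} K] (D : I ⥤ K)

/-- The restriction of a diagram to a subset of the indexing poset. -/
abbrev restrictSet (A : Set I) : A ⥤ K := (Subtype.mono_coe (· ∈ A)).functor ⋙ D

variable [HasFilteredColimitsOfSize.{w, w} K] (θ : Cardinal.{w})

instance hasColimit_restrictSet (A : DirectedSubset I θ) :
    HasColimit (restrictSet D A.1) :=
  have := HasFilteredColimitsOfSize.HasColimitsOfShape (C := K) A.1
  inferInstance

/-- The cocone on a restricted diagram given by a compatible family of morphisms. -/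
def restrictSetCocone (A : Set I) {X : K} (φ : ∀ i ∈ A, D.obj i ⟶ X)
    (hφ : ∀ (i j : I) (hi : i ∈ A) (hj : j ∈ A) (f : i ⟶ j), D.map f ≫ φ j hj = φ i hi) :
    Cocone (restrictSet D A) where
  pt := X
  ι :=
    { app i := φ i.1 i.2
      naturality i j f := by
        have := hφ i.1 j.1 i.2 j.2 (homOfLE (leOfHom f))
        simpa using! this }

/-- The morphism between partial colimits induced by an inclusion. -/
noncomputable def partialMap {A B : DirectedSubset I θ} (h : A ≤ B) :
    colimit (restrictSet D A.1) ⟶ colimit (restrictSet D B.1) :=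
  colimit.desc (restrictSet D A.1) (restrictSetCocone D A.1
    (fun i hi ↦ colimit.ι (restrictSet D B.1) ⟨i, h hi⟩)
    (fun i j hi hj g ↦ colimit.w (restrictSet D B.1)
      (homOfLE (leOfHom g) : (⟨i, h hi⟩ : B.1) ⟶ ⟨j, h hj⟩)))

lemma ι_partialMap {A B : DirectedSubset I θ} (h : A ≤ B) (i : A.1) :
    colimit.ι (restrictSet D A.1) i ≫ partialMap D θ h =
      colimit.ι (restrictSet D B.1) ⟨i.1, h i.2⟩ :=
  colimit.ι_desc _ _

/-- The functor sending a directed subset `A` to the colimit of the diagram restricted to `A`. -/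
noncomputable def partialColimits : DirectedSubset I θ ⥤ K where
  obj A := colimit (restrictSet D A.1)
  map {A B} f := partialMap D θ (leOfHom f)
  map_id A := colimit.hom_ext (fun i ↦ by rw [ι_partialMap, Category.comp_id])
  map_comp {A B C} f g := colimit.hom_ext (fun i ↦ by
    rw [ι_partialMap, ← Category.assoc, ι_partialMap]
    exact (ι_partialMap D θ (leOfHom g) ⟨i.1, leOfHom f i.2⟩).symm)

/-- The inclusion of a value of the diagram in a partial colimit. -/
noncomputable def partialι (A : DirectedSubset I θ) (i : I) (hi : i ∈ A.1) :
    D.obj i ⟶ (partialColimits D θ).obj A :=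
  colimit.ι (restrictSet D A.1) ⟨i, hi⟩

lemma partialι_w (A : DirectedSubset I θ) {i j : I} (f : i ⟶ j) (hi : i ∈ A.1) (hj : j ∈ A.1) :
    D.map f ≫ partialι D θ A j hj = partialι D θ A i hi :=
  colimit.w (restrictSet D A.1) (homOfLE (leOfHom f) : (⟨i, hi⟩ : A.1) ⟶ ⟨j, hj⟩)

lemma partialι_map {A B : DirectedSubset I θ} (f : A ⟶ B) (i : I) (hi : i ∈ A.1) :
    partialι D θ A i hi ≫ (partialColimits D θ).map f = partialι D θ B i (leOfHom f hi) :=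
  ι_partialMap ..

variable {D θ} in
lemma partial_hom_ext {A : DirectedSubset I θ} {X : K}
    {f g : (partialColimits D θ).obj A ⟶ X}
    (h : ∀ i hi, partialι D θ A i hi ≫ f = partialι D θ A i hi ≫ g) : f = g :=
  colimit.hom_ext (fun ⟨i, hi⟩ ↦ h i hi)

/-- The morphism from a partial colimit given by a compatible family. -/
noncomputable def partialDesc (A : DirectedSubset I θ) {X : K} (φ : ∀ i ∈ A.1, D.obj i ⟶ X)
    (hφ : ∀ (i j : I) (hi : i ∈ A.1) (hj : j ∈ A.1) (f : i ⟶ j), D.map f ≫ φ j hj = φ i hi) :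
    (partialColimits D θ).obj A ⟶ X :=
  colimit.desc (restrictSet D A.1) (restrictSetCocone D A.1 φ hφ)

lemma partialι_desc (A : DirectedSubset I θ) {X : K} (φ : ∀ i ∈ A.1, D.obj i ⟶ X)
    (hφ : ∀ (i j : I) (hi : i ∈ A.1) (hj : j ∈ A.1) (f : i ⟶ j), D.map f ≫ φ j hj = φ i hi)
    (i : I) (hi : i ∈ A.1) :
    partialι D θ A i hi ≫ partialDesc D θ A φ hφ = φ i hi :=
  colimit.ι_desc _ _

variable {D}

/-- A cocone on a diagram induces a cocone on its partial colimits. -/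
noncomputable def partialCocone (c : Cocone D) : Cocone (partialColimits D θ) where
  pt := c.pt
  ι :=
    { app A := partialDesc D θ A (fun i _ ↦ c.ι.app i) (by simp)
      naturality A B f := partial_hom_ext (fun i hi ↦ by
        rw [← Category.assoc, partialι_map, partialι_desc]
        simp [partialι_desc]) }

lemma partialι_partialCocone (c : Cocone D) (A : DirectedSubset I θ) (i : I) (hi : i ∈ A.1) :
    partialι D θ A i hi ≫ (partialCocone θ c).ι.app A = c.ι.app i :=
  partialι_desc ..

variable {θ} in
/-- An object which is the colimit of a directed diagram is the colimit of the
partial colimits over directed subsets of cardinality `< θ`. -/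
noncomputable def isColimitPartialCocone [IsFiltered I] [Fact θ.IsRegular]
    (hθ : Cardinal.aleph0 < θ) {c : Cocone D} (hc : IsColimit c) :
    IsColimit (partialCocone θ c) := by
  have hex (S : Set I) (hS : S.Finite) : ∃ A : DirectedSubset I θ, S ⊆ A.1 :=
    have := hS.to_subtype
    exists_directedSubset hθ S (hasCardinalLT_of_finite _ _ hθ.le)
  choose A hA using fun i : I ↦ hex {i} (Set.finite_singleton i)
  have hA' (i : I) : i ∈ (A i).1 := hA i rfl
  -- The leg at `i` is independent of the directed subset containing `i`: compare in an upper bound.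
  have key (s : Cocone (partialColimits D θ)) (i : I) (B B' : DirectedSubset I θ)
      (hB : i ∈ B.1) (hB' : i ∈ B'.1) :
      partialι D θ B i hB ≫ s.ι.app B = partialι D θ B' i hB' ≫ s.ι.app B' := by
    have := isCardinalFiltered_directedSubset (I := I) hθ
    have := isFiltered_of_isCardinalFiltered (DirectedSubset I θ) θ
    rw [← s.w (IsFiltered.leftToMax B B'), ← s.w (IsFiltered.rightToMax B B'),
      ← Category.assoc, ← Category.assoc, partialι_map, partialι_map]
  let t (s : Cocone (partialColimits D θ)) : Cocone D :=
    { pt := s.pt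
      ι :=
        { app i := partialι D θ (A i) i (hA' i) ≫ s.ι.app (A i)
          naturality i j f := by
            obtain ⟨B, hB⟩ := hex {i, j} (by simp)
            have hi : i ∈ B.1 := hB (by simp)
            have hj : j ∈ B.1 := hB (by simp)
            rw [key s i _ B _ hi, key s j _ B _ hj, ← Category.assoc, partialι_w D θ B f hi hj]
            exact (Category.comp_id _).symm } }
  exact
    { desc s := hc.desc (t s)
      fac s B := partial_hom_ext (fun i hi ↦ by
        refine (Category.assoc _ _ _).symm.trans ?_
        refine (congr_arg (· ≫ hc.desc (t s)) (partialι_partialCocone θ c B i hi)).trans ?_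
        exact (hc.fac (t s) i).trans (key s i _ _ _ _))
      uniq s m hm := hc.hom_ext (fun i ↦ by
        refine Eq.trans ?_ (hc.fac (t s) i).symm
        dsimp only [t]
        rw [← hm, ← Category.assoc, partialι_partialCocone]
        rfl) }

end DirectedSubsets

/-! ### Presentability ranks and the existence of `λ_U` -/

section Presentable

variable {K : Type u} [Category.{v} K]

/-- A `θ`-presentable object which is a directed colimit is a retract of the colimit over some
directed subset of cardinality `< θ`. -/
lemma exists_retract_partialColimits [HasFilteredColimitsOfSize.{w, w} K]
    {I : Type w} [PartialOrder I] [IsFiltered I] {D : I ⥤ K} {c : Cocone D} (hc : IsColimit c)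
    {θ : Cardinal.{w}} [Fact θ.IsRegular] (hθ : Cardinal.aleph0 < θ)
    (hX : IsCardinalPresentable c.pt θ) :
    ∃ (A : DirectedSubset I θ) (f : c.pt ⟶ (partialColimits D θ).obj A),
      f ≫ (partialCocone θ c).ι.app A = 𝟙 c.pt := by
  have := isCardinalFiltered_directedSubset (I := I) hθ
  exact IsCardinalPresentable.exists_hom_of_isColimit θ (isColimitPartialCocone hθ hc) (𝟙 c.pt)

/-- Objects of an accessible category are colimits of presentable objects indexed by
directed posets. -/
lemma exists_directed_presentation (lam : Cardinal.{w}) [Fact lam.IsRegular]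
    [IsCardinalAccessibleCategory K lam] (X : K) :
    ∃ (I : Type w) (_ : PartialOrder I) (_ : IsFiltered I) (D : I ⥤ K)
      (ι : D ⟶ (Functor.const I).obj X) (_ : IsColimit (Cocone.mk X ι)),
      ∀ i, IsCardinalPresentable (D.obj i) lam := by
  obtain ⟨J, _, _, ⟨p⟩⟩ :=
    (isCardinalFilteredGenerator_isCardinalPresentable K lam).exists_colimitsOfShape X
  obtain ⟨I, _, _, F, _⟩ := IsCardinalFiltered.exists_cardinal_directed J lam
  exact ⟨I, inferInstance, isFiltered_of_isCardinalFiltered I lam, F ⋙ p.diag,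
    Functor.whiskerLeft F p.ι,
    (Functor.Final.isColimitWhiskerEquiv F _).symm p.isColimit,
    fun i ↦ p.prop_diag_obj (F.obj i)⟩

lemma hasCardinalLT_arrow_of_preorder {A : Type w} [Preorder A] {θ : Cardinal.{w}}
    (hθ : Cardinal.aleph0 ≤ θ) (hA : HasCardinalLT A θ) : HasCardinalLT (Arrow A) θ :=
  (hasCardinalLT_prod hθ hA hA).of_injective (fun f ↦ (f.left, f.right)) (fun _ _ h ↦
    Arrow.ext (congr_arg Prod.fst h) (congr_arg Prod.snd h) (Subsingleton.elim _ _))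

lemma partialColimits_mem_colimitsCardinalClosure [HasFilteredColimitsOfSize.{w, w} K]
    {I : Type w} [PartialOrder I] {D : I ⥤ K} (P : ObjectProperty K) (hD : ∀ i, P (D.obj i))
    {θ : Cardinal.{w}} (hθ : Cardinal.aleph0 ≤ θ) (A : DirectedSubset I θ) :
    P.colimitsCardinalClosure θ ((partialColimits D θ).obj A) := by
  have := P.isClosedUnderColimitsOfShape_colimitsCardinalClosure θ A.1
    (hasCardinalLT_arrow_of_preorder hθ A.2.2)
  exact ObjectProperty.prop_colimit (P.colimitsCardinalClosure θ) (restrictSet D A.1)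
    (fun i ↦ P.le_colimitsCardinalClosure θ _ (hD _))

/-- Up to isomorphism there is only a small set of objects to bound. -/
lemma exists_cardinal_bound (U : K ⥤ Type w) (P : ObjectProperty K)
    [ObjectProperty.EssentiallySmall.{w} P] :
    ∃ σ : Cardinal.{w}, ∀ X, P X → Cardinal.mk (U.obj X) ≤ σ := by
  obtain ⟨Q, _, hQ⟩ := ObjectProperty.EssentiallySmall.exists_small_le'.{w} P
  obtain ⟨σ, -, hσ⟩ := HasCardinalLT.exists_regular_cardinal_forall.{w}
    (fun X : Subtype Q ↦ U.obj X.1)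
  refine ⟨σ, fun X hX ↦ ?_⟩
  obtain ⟨Y, hY, ⟨e⟩⟩ := hQ X hX
  have := ((hasCardinalLT_iff_of_equiv (U.mapIso e).toEquiv _).2 (hσ ⟨Y, hY⟩))
  rw [hasCardinalLT_iff_cardinal_mk_lt] at this
  exact this.le

/-- Rests on `(2 ^ τ) ^ τ = 2 ^ τ`, which is why `2 ^ τ` is the bound used below. -/
lemma mk_directedSubset_le {A : Type w} [PartialOrder A] {τ χ : Cardinal.{w}}
    (hτ : Cardinal.aleph0 ≤ τ) (hχ : χ ≤ τ) (hA : Cardinal.mk A ≤ 2 ^ τ) :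
    Cardinal.mk (DirectedSubset A χ) ≤ 2 ^ τ := by
  have hinj : Function.Injective (fun S : DirectedSubset A χ ↦
      (⟨S.1, ((hasCardinalLT_iff_cardinal_mk_lt _ _).1 S.2.2).le.trans hχ⟩ :
        { t : Set A // Cardinal.mk t ≤ τ })) :=
    fun S T h ↦ Subtype.ext (congr_arg (fun x ↦ x.1) h)
  refine (Cardinal.mk_le_of_injective hinj).trans ((Cardinal.mk_bounded_set_le A τ).trans ?_)
  calc max (Cardinal.mk A) Cardinal.aleph0 ^ τ ≤ (2 ^ τ) ^ τ :=
        Cardinal.power_le_power_right (max_le hA (hτ.trans (Cardinal.cantor τ).le))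
    _ = 2 ^ τ := by rw [← Cardinal.power_mul, Cardinal.mul_eq_self hτ]

/-- An accessible functor to types on an accessible category with directed colimits
preserves `θ`-presentable objects for some regular cardinal `θ` above a given one. -/
lemma exists_preservesPresentable [HasFilteredColimitsOfSize.{w, w} K] (U : K ⥤ Type w)
    (κ : Cardinal.{w}) [Fact κ.IsRegular] [U.IsCardinalAccessible κ]
    (lam : Cardinal.{w}) [Fact lam.IsRegular] [IsCardinalAccessibleCategory K lam] :
    ∃ θ : Cardinal.{w}, lam ≤ θ ∧ ∃ _ : Fact θ.IsRegular, PreservesPresentable U θ := by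
  have hκ : κ.IsRegular := Fact.out
  -- Uncountable, and above `κ` so that `U` preserves `χ`-directed colimits.
  let χ := Order.succ (max κ lam)
  have hχ₀ : Cardinal.aleph0 < χ :=
    (hκ.aleph0_le.trans (le_max_left _ _)).trans_lt (Order.lt_succ _)
  have : Fact χ.IsRegular :=
    ⟨Cardinal.isRegular_succ (hκ.aleph0_le.trans (le_max_left _ _))⟩
  obtain ⟨σ, hσ⟩ := exists_cardinal_bound U
    ((isCardinalPresentable K lam).colimitsCardinalClosure χ)
  let τ := max σ χ
  have hχτ : χ ≤ τ := le_max_right _ _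
  have hτ : Cardinal.aleph0 ≤ τ := hχ₀.le.trans hχτ
  have hν : Cardinal.aleph0 ≤ (2 : Cardinal.{w}) ^ τ := hτ.trans (Cardinal.cantor τ).le
  let θ := Order.succ ((2 : Cardinal.{w}) ^ τ)
  have hθ₀ : Cardinal.aleph0 < θ := hν.trans_lt (Order.lt_succ _)
  have hθ : Fact θ.IsRegular := ⟨Cardinal.isRegular_succ hν⟩
  refine ⟨θ, ?_, hθ, fun X hX ↦ ?_⟩
  · exact ((le_max_right κ lam).trans (Order.le_succ _)).trans
      (hχτ.trans ((Cardinal.cantor τ).le.trans (Order.le_succ _)))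
  obtain ⟨I, _, _, D, ι, hc, hD⟩ := exists_directed_presentation lam X
  obtain ⟨A, f, hf⟩ := exists_retract_partialColimits hc hθ₀ hX
  let D' := restrictSet D A.1
  have hcf : IsCardinalFiltered (DirectedSubset A.1 χ) χ := isCardinalFiltered_directedSubset hχ₀
  have : IsCardinalFiltered (DirectedSubset A.1 χ) κ :=
    .of_le _ ((le_max_left κ lam).trans (Order.le_succ _))
  have := U.preservesColimitsOfShape_of_isCardinalAccessible κ (DirectedSubset A.1 χ)
  -- Second decomposition: `colimit D'` is a `χ`-directed colimit of at most `2 ^ τ` objects whose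
  -- underlying sets have cardinality at most `σ`.
  have hcol := isColimitOfPreserves U (isColimitPartialCocone hχ₀ (colimit.isColimit D'))
  have hsurj : Function.Surjective
      (fun x : Σ B : DirectedSubset A.1 χ, U.obj ((partialColimits D' χ).obj B) ↦
        (U.mapCocone (partialCocone χ (colimit.cocone D'))).ι.app x.1 x.2) := fun y ↦ by
    obtain ⟨B, x, hx⟩ := Types.jointly_surjective_of_isColimit hcol y
    exact ⟨⟨B, x⟩, hx⟩
  have : IsSplitMono f := .mk' ⟨_, hf⟩
  have hinj : Function.Injective (U.map f) := (mono_iff_injective _).1 inferInstance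
  rw [Types.isCardinalPresentable_iff, hasCardinalLT_iff_cardinal_mk_lt, Order.lt_succ_iff]
  refine (Cardinal.mk_le_of_injective hinj).trans ((Cardinal.mk_le_of_surjective hsurj).trans ?_)
  rw [Cardinal.mk_sigma]
  refine (Cardinal.sum_le_mk_mul_iSup _).trans ?_
  rw [← Cardinal.mul_eq_self hν]
  gcongr
  · refine mk_directedSubset_le hτ hχτ ?_
    have := A.2.2
    rwa [hasCardinalLT_iff_cardinal_mk_lt, Order.lt_succ_iff] at this
  · exact ciSup_le' (fun B ↦ (hσ _ (partialColimits_mem_colimitsCardinalClosure _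
      (fun i ↦ hD _) hχ₀.le B)).trans ((le_max_left σ χ).trans (Cardinal.cantor τ).le))

/-- The cardinal `λ_U` is regular, and `U` preserves `λ_U`-presentable objects. -/
lemma lambdaU_spec [HasFilteredColimitsOfSize.{w, w} K] (U : K ⥤ Type w)
    (κ : Cardinal.{w}) [Fact κ.IsRegular] [U.IsCardinalAccessible κ]
    (lam : Cardinal.{w}) [Fact lam.IsRegular] [IsCardinalAccessibleCategory K lam] :
    lam ≤ lambdaU U lam ∧
      ∃ _ : Fact (lambdaU U lam).IsRegular, PreservesPresentable U (lambdaU U lam) :=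
  csInf_mem (s := {θ | lam ≤ θ ∧ ∃ _ : Fact θ.IsRegular, PreservesPresentable U θ})
    (exists_preservesPresentable U κ lam)

end Presentable

/-! ### Embedding initial segments of the chain into extensions of `N` -/

section PartialExtensions

variable {K : Type u} [Category.{v} K] (U : K ⥤ Type w)
  {J : Type w} [LinearOrder J] [OrderBot J] [SuccOrder J]
  (F : J ⥤ K) {N : K} (h : F.obj ⊥ ⟶ N) (a : J → Option (U.obj N))

/-- An extension of `N` together with a compatible embedding of an initial segment of the chain
`F`, such that the elements of `N` prescribed by `a` are in the image of the corresponding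
successor stages. -/
structure PartialExtension where
  /-- the extension -/
  obj : K
  /-- the structure morphism of the extension -/
  base : N ⟶ obj
  /-- the indices of the stages of the chain which are embedded in the extension -/
  dom : LowerSet J
  /-- the embeddings of the stages of the chain -/
  map (j : J) (hj : j ∈ dom) : F.obj j ⟶ obj
  w {i j : J} (hij : i ≤ j) (hj : j ∈ dom) :
    F.map (homOfLE hij) ≫ map j hj = map i (dom.lower hij hj)
  bot_mem : ⊥ ∈ dom
  map_bot : map ⊥ bot_mem = h ≫ base
  realizes (i : J) (hi : Order.succ i ∈ dom) (x : U.obj N) (hx : a i = some x) :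
    ∃ y, U.map (map (Order.succ i) hi) y = U.map base x

namespace PartialExtension

variable {U F h a}

/-- Morphisms of partial extensions. -/
@[ext]
structure Hom (X Y : PartialExtension U F h a) where
  /-- the underlying morphism -/
  hom : X.obj ⟶ Y.obj
  base_hom : X.base ≫ hom = Y.base
  dom_le : X.dom ≤ Y.dom
  map_hom (j : J) (hj : j ∈ X.dom) : X.map j hj ≫ hom = Y.map j (dom_le hj)

instance : Category (PartialExtension U F h a) where
  Hom := Hom
  id X := ⟨𝟙 _, by simp, le_rfl, by simp⟩
  comp f g := ⟨f.hom ≫ g.hom, by rw [← Category.assoc, f.base_hom, g.base_hom],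
    f.dom_le.trans g.dom_le,
    fun j hj ↦ by rw [← Category.assoc, f.map_hom, g.map_hom]⟩

lemma hom_ext {X Y : PartialExtension U F h a} {f g : X ⟶ Y} (hfg : f.hom = g.hom) : f = g :=
  Hom.ext hfg

variable (U F h a) in
/-- The functor sending a partial extension to the extension. -/
def forget : PartialExtension U F h a ⥤ K where
  obj X := X.obj
  map f := f.hom

section Colimits

variable {T : Type w} [SmallCategory T] (G : T ⥤ PartialExtension U F h a)

/-- The legs of a cocone of extensions. -/
def leg (c : Cocone (G ⋙ forget U F h a)) (t : T) : (G.obj t).obj ⟶ c.pt := c.ι.app t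

lemma hom_leg (c : Cocone (G ⋙ forget U F h a)) {t t' : T} (f : t ⟶ t') :
    (G.map f).hom ≫ leg G c t' = leg G c t :=
  c.w f

lemma leg_desc {c : Cocone (G ⋙ forget U F h a)} (hc : IsColimit c) (s : Cocone G) (t : T) :
    leg G c t ≫ hc.desc ((forget U F h a).mapCocone s) = (s.ι.app t).hom :=
  hc.fac _ t

variable [IsFiltered T]

lemma base_leg (c : Cocone (G ⋙ forget U F h a)) (t t' : T) :
    (G.obj t).base ≫ leg G c t = (G.obj t').base ≫ leg G c t' := by
  rw [← hom_leg G c (IsFiltered.leftToMax t t'), ← hom_leg G c (IsFiltered.rightToMax t t'),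
    ← Category.assoc, ← Category.assoc, Hom.base_hom, Hom.base_hom]

/-- Makes the choice of index in `glue` harmless. -/
lemma map_leg (c : Cocone (G ⋙ forget U F h a)) (t t' : T) (j : J)
    (ht : j ∈ (G.obj t).dom) (ht' : j ∈ (G.obj t').dom) :
    (G.obj t).map j ht ≫ leg G c t = (G.obj t').map j ht' ≫ leg G c t' := by
  rw [← hom_leg G c (IsFiltered.leftToMax t t'), ← hom_leg G c (IsFiltered.rightToMax t t'),
    ← Category.assoc, ← Category.assoc, Hom.map_hom, Hom.map_hom]

/-- The partial extension supported by the vertex of a cocone of extensions. -/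
noncomputable def glue (c : Cocone (G ⋙ forget U F h a)) : PartialExtension U F h a where
  obj := c.pt
  base := (G.obj (IsFiltered.nonempty (C := T)).some).base ≫ leg G c _
  dom := ⨆ t, (G.obj t).dom
  map j hj := (G.obj (LowerSet.mem_iSup_iff.1 hj).choose).map j
    (LowerSet.mem_iSup_iff.1 hj).choose_spec ≫ leg G c _
  w {i j} hij hj := by
    rw [← Category.assoc, (G.obj _).w]
    apply map_leg
  bot_mem := LowerSet.mem_iSup_iff.2 ⟨(IsFiltered.nonempty (C := T)).some, (G.obj _).bot_mem⟩
  map_bot := by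
    rw [map_leg G c _ (IsFiltered.nonempty (C := T)).some _ _ (G.obj _).bot_mem,
      (G.obj _).map_bot, Category.assoc]
  realizes i hi x hx := by
    obtain ⟨y, hy⟩ := (G.obj (LowerSet.mem_iSup_iff.1 hi).choose).realizes i
      (LowerSet.mem_iSup_iff.1 hi).choose_spec x hx
    refine ⟨y, ?_⟩
    rw [base_leg G c _ (LowerSet.mem_iSup_iff.1 hi).choose, U.map_comp, U.map_comp]
    exact congr_arg (U.map (leg G c _)) hy

/-- The legs of a cocone of extensions, as morphisms of partial extensions. -/
noncomputable def toGlue (c : Cocone (G ⋙ forget U F h a)) (t : T) : G.obj t ⟶ glue G c where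
  hom := leg G c t
  base_hom := base_leg ..
  dom_le := le_iSup (fun t ↦ (G.obj t).dom) t
  map_hom _ _ := map_leg ..

/-- The cocone with vertex `glue G c`. -/
noncomputable def glueCocone (c : Cocone (G ⋙ forget U F h a)) : Cocone G where
  pt := glue G c
  ι :=
    { app := toGlue G c
      naturality _ _ f := hom_ext (c.ι.naturality f) }

/-- The morphism of partial extensions from a colimit of extensions. -/
noncomputable def glueDesc {c : Cocone (G ⋙ forget U F h a)} (hc : IsColimit c) (s : Cocone G) :
    glue G c ⟶ s.pt where
  hom := hc.desc ((forget U F h a).mapCocone s)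
  base_hom := (Category.assoc _ _ _).trans
    ((congr_arg (_ ≫ ·) (leg_desc G hc s _)).trans (s.ι.app _).base_hom)
  dom_le := iSup_le (fun t ↦ (s.ι.app t).dom_le)
  map_hom j _ := (Category.assoc _ _ _).trans
    ((congr_arg (_ ≫ ·) (leg_desc G hc s _)).trans ((s.ι.app _).map_hom j _))

/-- Filtered colimits of partial extensions are computed on the underlying objects. -/
noncomputable def isColimitGlueCocone {c : Cocone (G ⋙ forget U F h a)} (hc : IsColimit c) :
    IsColimit (glueCocone G c) where
  desc := glueDesc G hc
  fac s t := hom_ext (hc.fac ((forget U F h a).mapCocone s) t)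
  uniq s m hm := hom_ext (hc.uniq ((forget U F h a).mapCocone s) m.hom
    (fun t ↦ congr_arg Hom.hom (hm t)))

end Colimits

lemma hasColimitsOfShape [HasFilteredColimitsOfSize.{w, w} K] (T : Type w) [SmallCategory T]
    [IsFiltered T] : HasColimitsOfShape T (PartialExtension U F h a) where
  has_colimit G :=
    have := HasFilteredColimitsOfSize.HasColimitsOfShape (C := K) T
    ⟨⟨_, isColimitGlueCocone G (colimit.isColimit _)⟩⟩

lemma hasIterationOfShape [HasFilteredColimitsOfSize.{w, w} K] :
    HasIterationOfShape J (PartialExtension U F h a) where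
  hasColimitsOfShape_of_isSuccLimit j hj := by
    have : Nonempty (Set.Iio j) := ⟨⊥, hj.bot_lt⟩
    exact hasColimitsOfShape _
  hasColimitsOfShape := hasColimitsOfShape _

/-! ### Adding one stage, and transfinite iteration -/

variable (U F h a) in
/-- The partial extension given by `N`. -/
def initial [NoMaxOrder J] : PartialExtension U F h a where
  obj := N
  base := 𝟙 N
  dom := LowerSet.Iic ⊥
  map j hj := F.map (homOfLE hj) ≫ h
  w hij hj := by rw [← Category.assoc, ← F.map_comp]; rfl
  bot_mem := le_rfl
  map_bot := by simp
  realizes i hi := ((Order.bot_lt_succ i).not_ge hi).elim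

/-- Add one more stage of the chain to a partial extension. -/
def extend (X : PartialExtension U F h a) {j : J} (hX : ∀ i, i ∈ X.dom ↔ i < j) {P : K}
    (g : X.obj ⟶ P) (φ : F.obj j ⟶ P)
    (hφ : ∀ (i : J) (hi : i < j), F.map (homOfLE hi.le) ≫ φ = X.map i ((hX i).2 hi) ≫ g)
    (hj : ∀ (i : J), Order.succ i = j → ∀ x, a i = some x →
      ∃ y, U.map φ y = U.map g (U.map X.base x)) :
    PartialExtension U F h a where
  obj := P
  base := X.base ≫ g
  dom := LowerSet.Iic j
  map i hi := F.map (homOfLE hi) ≫ φ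
  w hij hj := by rw [← Category.assoc, ← F.map_comp]; rfl
  bot_mem := bot_le
  map_bot := by
    rw [hφ ⊥ ((hX ⊥).1 X.bot_mem), X.map_bot, Category.assoc]
  realizes i hi x hx := by
    obtain hi' | hi' := lt_or_eq_of_le (show Order.succ i ≤ j from hi)
    · obtain ⟨y, hy⟩ := X.realizes i ((hX _).2 hi') x hx
      refine ⟨y, ?_⟩
      rw [hφ _ hi', U.map_comp, U.map_comp]
      exact congr_arg (U.map g) hy
    · obtain ⟨y, hy⟩ := hj i hi' x hx
      subst hi'
      refine ⟨y, ?_⟩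
      have hid : F.map (homOfLE hi) ≫ φ = φ := by
        rw [show homOfLE hi = 𝟙 _ from rfl, F.map_id, Category.id_comp]
      rw [hid, U.map_comp]
      exact hy

/-- The morphism to a partial extension with one more stage. -/
def toExtend (X : PartialExtension U F h a) {j : J} (hX : ∀ i, i ∈ X.dom ↔ i < j) {P : K}
    (g : X.obj ⟶ P) (φ : F.obj j ⟶ P)
    (hφ : ∀ (i : J) (hi : i < j), F.map (homOfLE hi.le) ≫ φ = X.map i ((hX i).2 hi) ≫ g)
    (hj : ∀ (i : J), Order.succ i = j → ∀ x, a i = some x →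
      ∃ y, U.map φ y = U.map g (U.map X.base x)) :
    X ⟶ X.extend hX g φ hφ hj where
  hom := g
  base_hom := rfl
  dom_le := fun i hi ↦ ((hX i).1 hi).le
  map_hom i hi := (hφ i ((hX i).1 hi)).symm

/-- A partial extension can be extended to the first stage of the chain which is not embedded. -/
lemma exists_hom_of_lt [WellFoundedLT J] [NoMaxOrder J] [F.IsWellOrderContinuous]
    (hAP : HasAmalgamation K)
    (hF : ∀ j, realizesAllTypes U (F.map (homOfLE (Order.le_succ j))))
    (X : PartialExtension U F h a) :
    ∃ (Y : PartialExtension U F h a) (_ : X ⟶ Y), ∀ j, (∀ i < j, i ∈ X.dom) → j ∈ Y.dom := by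
  by_cases hdom : ∀ j, j ∈ X.dom
  · exact ⟨X, 𝟙 X, fun j _ ↦ hdom j⟩
  have hwf : ∃ j, j ∉ X.dom ∧ ∀ i < j, i ∈ X.dom := by
    push Not at hdom
    obtain ⟨j, hj, hj'⟩ := WellFounded.has_min (wellFounded_lt (α := J)) {j | j ∉ X.dom} hdom
    exact ⟨j, hj, fun i hi ↦ by_contra (fun hi' ↦ hj' i hi' hi)⟩
  obtain ⟨j, hj, hj'⟩ := hwf
  have hX (i : J) : i ∈ X.dom ↔ i < j :=
    ⟨fun hi ↦ lt_of_not_ge (fun hij ↦ hj (X.dom.lower hij hi)), hj' i⟩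
  suffices ∃ (P : K) (g : X.obj ⟶ P) (φ : F.obj j ⟶ P),
      (∀ (i : J) (hi : i < j), F.map (homOfLE hi.le) ≫ φ = X.map i ((hX i).2 hi) ≫ g) ∧
      ∀ (i : J), Order.succ i = j → ∀ x, a i = some x →
        ∃ y, U.map φ y = U.map g (U.map X.base x) by
    obtain ⟨P, g, φ, h₁, h₂⟩ := this
    refine ⟨_, X.toExtend hX g φ h₁ h₂, fun k hk ↦ ?_⟩
    exact le_of_not_gt (fun hjk ↦ hj (hk j hjk))
  induction j using SuccOrder.limitRecOn with
  | isMin j hmin => exact (hj (hmin.eq_bot ▸ X.bot_mem)).elim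
  | succ i hi _ =>
    have hiX : i ∈ X.dom := (hX i).2 (Order.lt_succ i)
    -- With no element prescribed at `i`, plain amalgamation suffices; otherwise realizing the type
    -- of that element over `F.obj i` provides the amalgam.
    have hex : ∃ (P : K) (g : X.obj ⟶ P) (φ : F.obj (Order.succ i) ⟶ P),
        X.map i hiX ≫ g = F.map (homOfLE (Order.le_succ i)) ≫ φ ∧
        ∀ x, a i = some x → ∃ y, U.map φ y = U.map g (U.map X.base x) := by
      obtain hx | ⟨x, hx⟩ := (a i).eq_none_or_eq_some
      · obtain ⟨P, g, φ, hP⟩ := hAP (X.map i hiX) (F.map (homOfLE (Order.le_succ i)))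
        exact ⟨P, g, φ, hP, by simp [hx]⟩
      · obtain ⟨y, P, g, φ, hP, hy⟩ := hF i (X.map i hiX) (U.map X.base x)
        refine ⟨P, g, φ, hP, fun x' hx' ↦ ⟨y, ?_⟩⟩
        obtain rfl : x = x' := Option.some_injective _ (hx.symm.trans hx')
        exact hy.symm
    obtain ⟨P, g, φ, h₁, h₂⟩ := hex
    refine ⟨P, g, φ, fun k hk ↦ ?_, fun k hk ↦ ?_⟩
    · have hki : k ≤ i := Order.lt_succ_iff.1 hk
      rw [← X.w hki hiX, Category.assoc, h₁, ← Category.assoc, ← F.map_comp]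
      rfl
    · obtain rfl := Order.succ_injective hk
      exact h₂
  | isSuccLimit j hlim _ =>
    let s : Cocone ((Set.principalSegIio j).monotone.functor ⋙ F) :=
      { pt := X.obj
        ι :=
          { app i := X.map i.1 ((hX _).2 i.2)
            naturality i i' f := by
              have := X.w (leOfHom f) ((hX _).2 i'.2)
              exact this.trans (Category.comp_id _).symm } }
    let hc := F.isColimitOfIsWellOrderContinuous j hlim
    -- At a limit the extension need not grow, and no element is to be captured since `j` is not a
    -- successor.
    refine ⟨X.obj, 𝟙 _, hc.desc s, fun i hi ↦ ?_, fun i hi ↦ ?_⟩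
    · exact (hc.fac s ⟨i, hi⟩).trans (Category.comp_id _).symm
    · exact (hlim.isSuccPrelimit.succ_ne i hi).elim

/-- There is a partial extension in which the whole chain embeds. -/
lemma exists_dom_eq_top [WellFoundedLT J] [NoMaxOrder J] [F.IsWellOrderContinuous]
    [HasFilteredColimitsOfSize.{w, w} K] (hAP : HasAmalgamation K)
    (hF : ∀ j, realizesAllTypes U (F.map (homOfLE (Order.le_succ j)))) :
    ∃ X : PartialExtension U F h a, ∀ j, j ∈ X.dom := by
  choose succ toSucc hsucc using exists_hom_of_lt (h := h) (a := a) hAP hF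
  let Φ : SmallObject.SuccStruct (PartialExtension U F h a) :=
    { X₀ := initial U F h a
      succ := succ
      toSucc := toSucc }
  have := hasIterationOfShape (U := U) (F := F) (h := h) (a := a)
  let X := Φ.iterationFunctor J
  -- Step `j` of the iteration adds stage `j`: each `i < j` already lies in the domain at
  -- `Order.succ i ≤ j`.
  have hX (j : J) : j ∈ (X.obj (Order.succ j)).dom := by
    induction j using WellFoundedLT.induction with
    | ind j hj =>
      refine (Φ.iterationFunctorObjSuccIso j (not_isMax j)).inv.dom_le (hsucc _ j (fun i hi ↦ ?_))
      exact (X.map (homOfLE (Order.succ_le_of_lt hi))).dom_le (hj i hi)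
  exact ⟨Φ.iteration J, fun j ↦ ((Φ.iterationCocone J).ι.app (Order.succ j)).dom_le (hX j)⟩

end PartialExtension

end PartialExtensions

/-! ### Coherence and the amalgam absorbing the prescribed elements -/

section Universal

variable {K : Type u} [Category.{v} K] {U : K ⥤ Type w}

/-- In a coherent pair with `U` faithful, a morphism `A ⟶ C` factors through `B ⟶ C` as soon as
it does so on underlying elements. -/
lemma IsCoherent.exists_factorization [U.Faithful] (hU : IsCoherent U) {A B C : K}
    (h : A ⟶ C) (g : B ⟶ C) (hg : ∀ x : U.obj A, ∃ y : U.obj B, U.map g y = U.map h x) :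
    ∃ t : A ⟶ B, t ≫ g = h := by
  choose φ hφ using hg
  have hcomp : (↾φ : U.obj A ⟶ U.obj B) ≫ U.map g = U.map h := by
    ext x
    exact hφ x
  obtain ⟨t, ht⟩ := hU h g (↾φ) hcomp
  exact ⟨t, U.map_injective (by rw [U.map_comp, ht, hcomp])⟩

/-- Elements of an extension `N` of the first object of a chain realizing types which are
enumerated along the chain are in the image of the colimit of the chain inside some
common extension. -/
lemma exists_amalgam [HasFilteredColimitsOfSize.{w, w} K] (hAP : HasAmalgamation K)
    {J : Type w} [LinearOrder J] [OrderBot J] [SuccOrder J] [WellFoundedLT J] [NoMaxOrder J]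
    {M M' N : K} {m : M ⟶ M'} (c : (realizesAllTypes U).TransfiniteCompositionOfShape J m)
    (h : M ⟶ N) (a : J → Option (U.obj N)) :
    ∃ (P : K) (g : M' ⟶ P) (k : N ⟶ P), m ≫ g = h ≫ k ∧
      ∀ j x, a j = some x → ∃ y, U.map g y = U.map k x := by
  obtain ⟨X, hX⟩ := PartialExtension.exists_dom_eq_top (U := U) (F := c.F)
    (h := c.isoBot.hom ≫ h) (a := a) hAP (fun j ↦ c.map_mem j (not_isMax j))
  let s : Cocone c.F :=
    { pt := X.obj
      ι :=
        { app j := X.map j (hX j)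
          naturality i j f := (X.w (leOfHom f) (hX j)).trans (Category.comp_id _).symm } }
  have hs (j : J) : c.incl.app j ≫ c.isColimit.desc s = X.map j (hX j) := c.isColimit.fac s j
  refine ⟨X.obj, c.isColimit.desc s, X.base, ?_, fun j x hx ↦ ?_⟩
  · calc m ≫ c.isColimit.desc s = c.isoBot.inv ≫ c.incl.app ⊥ ≫ c.isColimit.desc s :=
          (congr_arg (· ≫ c.isColimit.desc s) c.fac.symm).trans (Category.assoc _ _ _)
      _ = c.isoBot.inv ≫ (c.isoBot.hom ≫ h) ≫ X.base :=
          congr_arg (c.isoBot.inv ≫ ·) ((hs ⊥).trans X.map_bot)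
      _ = h ≫ X.base := by simp
  · obtain ⟨y, hy⟩ := X.realizes j (hX _) x hx
    rw [← hs] at hy
    refine ⟨U.map (c.incl.app (Order.succ j)) y, ?_⟩
    rw [← hy]
    exact (Functor.map_comp_apply U (c.incl.app (Order.succ j)) (c.isColimit.desc s) y).symm

/-- A family of cardinality at most `μ` can be enumerated by `μ.ord.ToType`. -/
lemma exists_enumeration {E : Type w} {X : Type w} {μ : Cardinal.{w}} (hE : Cardinal.mk E ≤ μ)
    (f : E → X) : ∃ a : μ.ord.ToType → Option X, ∀ x, ∃ j, a j = some (f x) := by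
  have : Nonempty (E ↪ μ.ord.ToType) := by
    rw [← Cardinal.le_def, Cardinal.mk_ord_toType]
    exact hE
  obtain ⟨e⟩ := this
  -- Indices outside the range of `e` get `none`, so `E` may be empty or smaller than `μ`.
  exact ⟨fun j ↦ (Function.partialInv e j).map f, fun x ↦
    ⟨e x, by simp [Function.partialInv_left e.injective]⟩⟩

end Universal

end WeakCAEC

/-- In a weak `κ`-CAEC with amalgamation, `lam`-accessible as a category, 1-special extensions
of size `μ` are universal, when `μ⁺` is sharply greater than `κ` and `μ ≥ λ_U`. (The regularity
of `μ⁺` just says that `μ` is infinite.) -/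
theorem mainTheorem3 {K : Type u} [Category.{v} K] (U : K ⥤ Type w)
    (κ : Cardinal.{w}) [Fact κ.IsRegular] (hK : WeakCAEC.IsWeakCAEC U κ)
    (hAP : WeakCAEC.HasAmalgamation K)
    (lam : Cardinal.{w}) [Fact lam.IsRegular] [IsCardinalAccessibleCategory K lam]
    (μ : Cardinal.{w}) [Fact (Order.succ μ).IsRegular]
    (hκμ : Cardinal.SharplyLT κ (Order.succ μ)) (hμ : WeakCAEC.lambdaU U lam ≤ μ)
    {M M' : K} (m : M ⟶ M') (hM : WeakCAEC.HasSize M μ) (hM' : WeakCAEC.HasSize M' μ)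
    (hm : WeakCAEC.IsOneSpecial U μ m) :
    WeakCAEC.IsUniversalOver μ m := by
  open WeakCAEC in
  intro N h _ hN
  have := hK.faithful
  have := hK.hasDirectedColimits
  have := hK.preservesDirectedColimits
  obtain ⟨hlam, hreg, hpres⟩ := lambdaU_spec U κ lam
  have hμ₀ : Cardinal.aleph0 ≤ μ := (Cardinal.IsRegular.aleph0_le Fact.out).trans hμ
  obtain ⟨_, ⟨c⟩⟩ := hm
  have : NoMaxOrder μ.ord.ToType := Cardinal.noMaxOrder hμ₀
  -- `N` is a retract of a directed colimit of at most `μ` objects of size less than `μ`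
  obtain ⟨I, _, _, D, ι, hc, hD⟩ := exists_directed_presentation lam N
  obtain ⟨A, f, hf⟩ := exists_retract_partialColimits hc (hμ₀.trans_lt (Order.lt_succ μ)) hN
  -- At most `μ` objects, each with fewer than `λ_U ≤ μ` elements.
  have hE : Cardinal.mk (Σ i : A.1, U.obj (D.obj i.1)) ≤ μ := by
    have hA := A.2.2
    rw [hasCardinalLT_iff_cardinal_mk_lt, Order.lt_succ_iff] at hA
    rw [Cardinal.mk_sigma]
    refine (Cardinal.sum_le_mk_mul_iSup _).trans
      ((mul_le_mul' hA (ciSup_le' (fun i ↦ ?_))).trans (Cardinal.mul_eq_self hμ₀).le)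
    have := hD i.1
    have := hpres (isCardinalPresentable_of_le (D.obj i.1) hlam)
    rw [Types.isCardinalPresentable_iff, hasCardinalLT_iff_cardinal_mk_lt] at this
    exact this.le.trans hμ
  obtain ⟨a, ha⟩ := exists_enumeration (X := U.obj N) hE (fun x ↦ U.map (ι.app x.1.1) x.2)
  obtain ⟨P, g, k, hgk, hak⟩ := exists_amalgam hAP c h a
  have := hK.mono g
  -- the objects of the diagram factor through `M'`
  have hfac (i : I) (hi : i ∈ A.1) : ∃ t : D.obj i ⟶ M', t ≫ g = ι.app i ≫ k :=
    hK.coherent.exists_factorization _ _ (fun x ↦ by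
      obtain ⟨j, hj⟩ := ha ⟨⟨i, hi⟩, x⟩
      obtain ⟨y, hy⟩ := hak j _ hj
      exact ⟨y, hy.trans (Functor.map_comp_apply U (ι.app i) k x).symm⟩)
  choose t ht using hfac
  let T : (partialColimits D (Order.succ μ)).obj A ⟶ M' :=
    partialDesc D _ A t (fun i j hi hj φ ↦ by
      rw [← cancel_mono g, Category.assoc, ht, ht, ← Category.assoc, ι.naturality]
      exact congr_arg (· ≫ k) (Category.comp_id _))
  have hT : T ≫ g = (partialCocone (Order.succ μ) (Cocone.mk N ι)).ι.app A ≫ k :=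
    partial_hom_ext (fun i hi ↦ by
      rw [← Category.assoc, partialι_desc, ht]
      refine Eq.trans ?_ (Category.assoc _ _ _)
      exact congr_arg (· ≫ k) (partialι_partialCocone _ (Cocone.mk N ι) A i hi).symm)
  have hfT : (f ≫ T) ≫ g = k := by
    rw [Category.assoc, hT]
    exact (Category.assoc _ _ _).symm.trans
      ((congr_arg (· ≫ k) hf).trans (Category.id_comp k))
  refine ⟨f ≫ T, ?_⟩
  rw [← cancel_mono g, hgk, Category.assoc]
  exact congr_arg (h ≫ ·) hfT
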